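/- Let $n\ge 0$, let $U\subset\mathbb{R}^n$ be an open neighbourhood of $0$, and let $f,g:U\to\mathbb{R}$ be $C^1$ functions with $f(0)=g(0)=0$ whose gradients $\nabla f,\nabla g:U\to\mathbb{R}^n$ are locally Lipschitz. Suppose that $\nabla f(0)=0$ and that there are constants $C,C'>0$ such that, for all $x$ in some neighbourhood of $0$, $$|(g-f)(x)|\le C\,|\nabla f(x)|^2,\qquad |\nabla (g-f)(x)|\le C'\,|\nabla f(x)|^2,$$ where $|\cdot|$ on $\mathbb{R}^n$ is the Euclidean norm. Then $f$ and $g$ are $C^0$-right equivalent: there is a homeomorphism $\varphi$ between two open neighbourhoods of $0$ in $\mathbb{R}^n$ with $\varphi(0)=0$ and $f=g\circ\varphi$ in a neighbourhood of $0$. -/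

import Mathlib

open Filter Topology

/-- Germs `f, g : (ℝⁿ, 0) → (ℝ, 0)` (given by representatives) are `C^r`-right equivalent: there is
a `C^r` diffeomorphism `φ` between open neighbourhoods of `0` (a homeomorphism when `r = 0`) with
`φ 0 = 0` and `f = g ∘ φ` in a neighbourhood of `0`. -/
def RightEquivalent {n : ℕ} (r : ℕ∞) (f g : EuclideanSpace ℝ (Fin n) → ℝ) : Prop :=
  ∃ φ : OpenPartialHomeomorph (EuclideanSpace ℝ (Fin n)) (EuclideanSpace ℝ (Fin n)),
    (0 : EuclideanSpace ℝ (Fin n)) ∈ φ.source ∧ φ 0 = 0 ∧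
    ContDiffOn ℝ r φ φ.source ∧ ContDiffOn ℝ r φ.symm φ.target ∧
    ∀ᶠ x in 𝓝 (0 : EuclideanSpace ℝ (Fin n)), f x = g (φ x)

open scoped NNReal

/-! Moser's homotopy method. With h = g - f and f_t = f + t h, a curve keeps f_t constant if its
velocity X_t satisfies ⟨∇f_t, X_t⟩ = -h; take X_t = -h ∇f_t / |∇f_t|², set to 0 where ∇f_t = 0. Near
0, |∇h| ≤ |∇f| / 2, so ∇f_t is comparable to ∇f and the bounds on h and ∇h hold relative to ∇f_t,
uniformly in t. They make X_t Lipschitz even across the critical set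
(`lipschitzOnWith_neg_div_norm_sq_smul`). Its short-time flow is a local homeomorphism fixing 0, and
finitely many such flows compose to cover [0, 1]. -/

/-! ### Lipschitz regularity of the Moser field -/

/-- If `h` is dominated by `‖p‖²` and its gradient by `‖p‖`, where `p` is a Lipschitz field, then
the field `-(h / ‖p‖²) p` is Lipschitz (including across the zero set of `p`). -/
theorem lipschitzOnWith_neg_div_norm_sq_smul {E : Type*} [NormedAddCommGroup E]
    [InnerProductSpace ℝ E] [CompleteSpace E] {B : Set E} (hB : Convex ℝ B) {h : E → ℝ}
    {p b : E → E} {C D : ℝ} {L : ℝ≥0} (hC : 0 ≤ C) (hD : 0 ≤ D)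
    (hh : ∀ x ∈ B, HasGradientAt h (b x) x) (hp : LipschitzOnWith L p B)
    (hhp : ∀ x ∈ B, |h x| ≤ C * ‖p x‖ ^ 2) (hbp : ∀ x ∈ B, ‖b x‖ ≤ D * ‖p x‖) :
    LipschitzOnWith (2 * C + D * (1 + L) + C * L).toNNReal
      (fun x => -(h x / ‖p x‖ ^ 2) • p x) B := by
  have hX : ∀ x ∈ B, ‖-(h x / ‖p x‖ ^ 2) • p x‖ ≤ C * ‖p x‖ := by
    intro x hx
    rcases (norm_nonneg (p x)).eq_or_lt with h0 | h0
    · simp [← h0]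
    · rw [norm_smul, norm_neg, norm_div, Real.norm_eq_abs, norm_pow, norm_norm]
      gcongr
      rw [div_le_iff₀ (by positivity)]
      exact hhp x hx
  have key : ∀ x ∈ B, ∀ y ∈ B, ‖p y‖ ≤ ‖p x‖ →
      dist (-(h x / ‖p x‖ ^ 2) • p x) (-(h y / ‖p y‖ ^ 2) • p y) ≤
        (2 * C + D * (1 + L) + C * L) * dist x y := by
    intro x hx y hy hyx
    have hd : 0 ≤ dist x y := dist_nonneg
    have hL : (0 : ℝ) ≤ L := L.2
    -- Near the zero set of `p` both values are separately O(dist x y). Otherwise `p` varies by at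
    -- most `L * ‖p x‖` along the segment, and the mean value inequality controls `h`.
    rcases le_or_gt ‖p x‖ (dist x y) with hxd | hxd
    · rw [dist_eq_norm]
      refine (norm_sub_le _ _).trans ((add_le_add (hX x hx) (hX y hy)).trans ?_)
      have h1 : C * ‖p x‖ ≤ C * dist x y := by gcongr
      have h2 : C * ‖p y‖ ≤ C * dist x y := by gcongr; exact hyx.trans hxd
      have h3 : 0 ≤ (D * (1 + L) + C * L) * dist x y := by positivity
      linarith
    · have hpx : 0 < ‖p x‖ := hd.trans_lt hxd
      have hhxy : |h x - h y| ≤ D * (1 + L) * ‖p x‖ * dist x y := by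
        rw [← Real.norm_eq_abs, dist_eq_norm]
        refine (convex_segment x y).norm_image_sub_le_of_norm_hasFDerivWithin_le
          (C := D * (1 + L) * ‖p x‖) (f' := fun z => InnerProductSpace.toDual ℝ E (b z))
          (fun z hz => ((hh z (hB.segment_subset hx hy hz)).hasFDerivAt).hasFDerivWithinAt)
          (fun z hz => ?_) (right_mem_segment ℝ x y) (left_mem_segment ℝ x y)
        · have hzB := hB.segment_subset hx hy hz
          rw [LinearIsometryEquiv.norm_map]
          refine (hbp z hzB).trans ?_
          rw [mul_assoc]
          gcongr
          have h1 : ‖p z‖ ≤ ‖p x‖ + dist (p z) (p x) := by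
            rw [dist_eq_norm]
            simpa using norm_add_le (p x) (p z - p x)
          have h2 : dist z x ≤ dist x y := by
            rw [dist_comm x y]
            have := (convex_closedBall x (dist y x)).segment_subset
              (Metric.mem_closedBall_self dist_nonneg) (Metric.mem_closedBall.2 le_rfl) hz
            exact this
          have h3 : dist (p z) (p x) ≤ L * ‖p x‖ := by
            refine (hp.dist_le_mul z hzB x hx).trans ?_
            gcongr
            exact h2.trans hxd.le
          linarith
      -- The last bracket is a difference of inversions, of norm |p x - p y| / (|p x| |p y|); the
      -- factor |h y| ≤ C |p y|² ≤ C |p x| |p y| cancels the denominator.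
      have hdecomp : -(h x / ‖p x‖ ^ 2) • p x - -(h y / ‖p y‖ ^ 2) • p y =
          -((h x - h y) / ‖p x‖ ^ 2) • p x
            - h y • ((1 / ‖p x‖) ^ 2 • p x - (1 / ‖p y‖) ^ 2 • p y) := by
        module
      have h1 : ‖-((h x - h y) / ‖p x‖ ^ 2) • p x‖ ≤ D * (1 + L) * dist x y := by
        rw [norm_smul, norm_neg, norm_div, Real.norm_eq_abs, norm_pow, norm_norm,
          div_mul_eq_mul_div, div_le_iff₀ (by positivity)]
        calc |h x - h y| * ‖p x‖ ≤ (D * (1 + L) * ‖p x‖ * dist x y) * ‖p x‖ := by gcongr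
          _ = _ := by ring
      have h2 : ‖h y • ((1 / ‖p x‖) ^ 2 • p x - (1 / ‖p y‖) ^ 2 • p y)‖ ≤ C * L * dist x y := by
        rcases (norm_nonneg (p y)).eq_or_lt with h0 | h0
        · have : h y = 0 := by
            have := hhp y hy
            rw [← h0] at this
            simpa using this
          rw [this, zero_smul, norm_zero]
          positivity
        · rw [norm_smul, ← dist_eq_norm,
            dist_div_norm_sq_smul (norm_pos_iff.1 hpx) (norm_pos_iff.1 h0), Real.norm_eq_abs,
            one_pow, div_mul_eq_mul_div, one_mul, mul_div_assoc', div_le_iff₀ (by positivity)]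
          calc |h y| * dist (p x) (p y) ≤ (C * ‖p y‖ ^ 2) * (L * dist x y) := by
                gcongr
                · exact hhp y hy
                · exact hp.dist_le_mul x hx y hy
            _ = C * L * dist x y * (‖p y‖ * ‖p y‖) := by ring
            _ ≤ C * L * dist x y * (‖p x‖ * ‖p y‖) := by gcongr
      rw [dist_eq_norm, hdecomp]
      refine (norm_sub_le _ _).trans ((add_le_add h1 h2).trans ?_)
      have h3 : 0 ≤ 2 * C * dist x y := by positivity
      linarith
  refine LipschitzOnWith.of_dist_le_mul fun x hx y hy => ?_
  rw [Real.coe_toNNReal _ (by positivity)]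
  rcases le_total ‖p y‖ ‖p x‖ with hxy | hxy
  · exact key x hx y hy hxy
  · rw [dist_comm, dist_comm x y]
    exact key y hy x hx hxy

/-! ### Short-time flows -/

/-- The short-time flow of a time-dependent Lipschitz vector field vanishing at `0` is a local
homeomorphism fixing `0`. -/
theorem exists_openPartialHomeomorph_flow {E : Type*} [NormedAddCommGroup E] [NormedSpace ℝ E]
    [CompleteSpace E] {v : ℝ → E → E} {K : ℝ≥0} {a t₀ T : ℝ} (ha : 0 < a) (hT : 0 ≤ T)
    (hKT : K * T ≤ 1 / 4)
    (hv : ∀ t ∈ Set.Icc t₀ (t₀ + T), LipschitzOnWith K (v t) (Metric.closedBall 0 a))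
    (hvt : ∀ x ∈ Metric.closedBall (0 : E) a, ContinuousOn (v · x) (Set.Icc t₀ (t₀ + T)))
    (hv0 : ∀ t ∈ Set.Icc t₀ (t₀ + T), v t 0 = 0) :
    ∃ φ : OpenPartialHomeomorph E E, φ.source = Metric.ball 0 (a / 2) ∧ φ 0 = 0 ∧
      ∀ x ∈ φ.source, ∃ γ : ℝ → E, γ t₀ = x ∧ γ (t₀ + T) = φ x ∧
        ∀ t ∈ Set.Icc t₀ (t₀ + T), γ t ∈ Metric.closedBall 0 a ∧
          HasDerivWithinAt γ (v t (γ t)) (Set.Icc t₀ (t₀ + T)) t := by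
  have hle : t₀ ≤ t₀ + T := by linarith
  have hl : t₀ ∈ Set.Icc t₀ (t₀ + T) := Set.left_mem_Icc.2 hle
  have hr : t₀ + T ∈ Set.Icc t₀ (t₀ + T) := Set.right_mem_Icc.2 hle
  have h0a : (0 : E) ∈ Metric.closedBall (0 : E) a := Metric.mem_closedBall_self ha.le
  have hPL : IsPicardLindelof v (tmin := t₀) (tmax := t₀ + T) ⟨t₀, hl⟩ (0 : E)
      a.toNNReal (a / 2).toNNReal (K * a.toNNReal) K := by
    refine ⟨?_, ?_, ?_, ?_⟩
    · rwa [Real.coe_toNNReal _ ha.le]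
    · rwa [Real.coe_toNNReal _ ha.le]
    · rw [Real.coe_toNNReal _ ha.le]
      intro t ht x hx
      have := (hv t ht).dist_le_mul x hx 0 h0a
      rw [hv0 t ht, dist_zero_right, dist_zero_right] at this
      rw [NNReal.coe_mul, Real.coe_toNNReal _ ha.le]
      refine this.trans ?_
      gcongr
      simpa using hx
    · rw [NNReal.coe_mul, Real.coe_toNNReal _ ha.le, Real.coe_toNNReal _ (by positivity)]
      simp only [add_sub_cancel_left, sub_self, max_eq_left hT]
      nlinarith
  have hex : ∀ x ∈ Metric.ball (0 : E) (a / 2), ∃ γ : ℝ → E, γ t₀ = x ∧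
      ∀ t ∈ Set.Icc t₀ (t₀ + T), γ t ∈ Metric.closedBall 0 a ∧
        HasDerivWithinAt γ (v t (γ t)) (Set.Icc t₀ (t₀ + T)) t := by
    intro x hx
    have hx' : x ∈ Metric.closedBall (0 : E) (a / 2).toNNReal := by
      rw [Real.coe_toNNReal _ (by positivity)]
      exact Metric.ball_subset_closedBall hx
    -- The Picard fixed point itself is kept because it carries confinement to the ball, which
    -- Grönwall needs.
    obtain ⟨α, hα⟩ := ODE.FunSpace.exists_isFixedPt_next hPL hx'
    have hmem : ∀ t, α.compProj t ∈ Metric.closedBall (0 : E) a := fun t => by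
      have := α.compProj_mem_closedBall (t := t) hPL.mul_max_le
      rwa [Real.coe_toNNReal _ ha.le] at this
    refine ⟨α.compProj, by
      rw [ODE.FunSpace.compProj_of_mem hl, ← hα]
      exact ODE.FunSpace.next_apply₀ hPL hx' α,
      fun t ht => ⟨hmem t, ?_⟩⟩
    apply ODE.hasDerivWithinAt_picard_Icc hl hPL.continuousOn_uncurry
      α.continuous_compProj.continuousOn (fun _ _ => α.compProj_mem_closedBall hPL.mul_max_le)
      x ht |>.congr_of_mem _ ht
    intro t' ht'
    nth_rw 1 [← hα]
    rw [ODE.FunSpace.compProj_of_mem ht', ODE.FunSpace.next_apply]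
  choose! α hα0 hα using hex
  have hgron : ∀ x ∈ Metric.ball (0 : E) (a / 2), ∀ y ∈ Metric.ball (0 : E) (a / 2),
      ∀ t ∈ Set.Icc t₀ (t₀ + T), dist (α x t) (α y t) ≤ 3 * dist x y := by
    intro x hx y hy t ht
    have hright : ∀ z ∈ Metric.ball (0 : E) (a / 2), ∀ t ∈ Set.Ico t₀ (t₀ + T),
        HasDerivWithinAt (α z) (v t (α z t)) (Set.Ici t) t := fun z hz t ht =>
      (hα z hz t (Set.Ico_subset_Icc_self ht)).2.mono_of_mem_nhdsWithin (Icc_mem_nhdsGE_of_mem ht)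
    have := dist_le_of_trajectories_ODE_of_mem (δ := dist x y)
      (fun t ht => hv t (Set.Ico_subset_Icc_self ht))
      (fun t ht => (hα x hx t ht).2.continuousWithinAt) (hright x hx)
      (fun t ht => (hα x hx t (Set.Ico_subset_Icc_self ht)).1)
      (fun t ht => (hα y hy t ht).2.continuousWithinAt) (hright y hy)
      (fun t ht => (hα y hy t (Set.Ico_subset_Icc_self ht)).1)
      (by rw [hα0 x hx, hα0 y hy]) t ht
    refine this.trans ?_
    rw [mul_comm]
    gcongr
    have h1 : (K : ℝ) * (t - t₀) ≤ 1 := by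
      have : (K : ℝ) * (t - t₀) ≤ K * T := by
        gcongr
        linarith [ht.2]
      linarith
    linarith [Real.exp_le_exp.2 h1, Real.exp_one_lt_d9]
  -- The time-T map minus the identity has Lipschitz constant 3KT ≤ 3/4 < 1, where 3 bounds the
  -- Grönwall factor e. So the Lipschitz inverse function theorem applies.
  have happrox : ApproximatesLinearOn (fun x => α x (t₀ + T))
      (ContinuousLinearEquiv.refl ℝ E : E →L[ℝ] E) (Metric.ball (0 : E) (a / 2)) (3 / 4) := by
    intro x hx y hy
    have := norm_image_sub_le_of_norm_deriv_le_segment' (f := fun t => α x t - α y t)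
      (fun t ht => (hα x hx t ht).2.sub (hα y hy t ht).2) (C := K * (3 * dist x y))
      (fun t ht => by
        have ht' := Set.Ico_subset_Icc_self ht
        rw [← dist_eq_norm]
        refine ((hv t ht').dist_le_mul _ (hα x hx t ht').1 _ (hα y hy t ht').1).trans ?_
        gcongr
        exact hgron x hx y hy t ht') (t₀ + T) hr
    rw [hα0 x hx, hα0 y hy, add_sub_cancel_left] at this
    refine this.trans ?_
    rw [dist_eq_norm]
    push_cast
    nlinarith [norm_nonneg (x - y)]
  have hc : Subsingleton E ∨ (3 / 4 : ℝ≥0) <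
      ‖((ContinuousLinearEquiv.refl ℝ E).symm : E →L[ℝ] E)‖₊⁻¹ := by
    rcases subsingleton_or_nontrivial E with hE | hE
    · exact Or.inl hE
    · right
      have : ‖((ContinuousLinearEquiv.refl ℝ E).symm : E →L[ℝ] E)‖₊ = 1 :=
        ContinuousLinearMap.nnnorm_id
      rw [this, inv_one, ← NNReal.coe_lt_coe]
      norm_num
  have h0 : (0 : E) ∈ Metric.ball (0 : E) (a / 2) := Metric.mem_ball_self (by positivity)
  refine ⟨happrox.toOpenPartialHomeomorph _ _ hc Metric.isOpen_ball, rfl, ?_,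
    fun x hx => ⟨α x, hα0 x hx, rfl, hα x hx⟩⟩
  have huniq := dist_le_of_trajectories_ODE_of_mem (δ := 0) (g := fun _ => (0 : E))
      (fun t ht => hv t (Set.Ico_subset_Icc_self ht))
      (fun t ht => (hα 0 h0 t ht).2.continuousWithinAt)
      (fun t ht => (hα 0 h0 t (Set.Ico_subset_Icc_self ht)).2.mono_of_mem_nhdsWithin
        (Icc_mem_nhdsGE_of_mem ht))
      (fun t ht => (hα 0 h0 t (Set.Ico_subset_Icc_self ht)).1)
      continuousOn_const
      (fun t ht => by
        simp only [hv0 t (Set.Ico_subset_Icc_self ht)]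
        exact hasDerivWithinAt_const _ _ _)
      (fun t _ => h0a)
      (by rw [hα0 0 h0, dist_self]) (t₀ + T) hr
  rw [zero_mul] at huniq
  exact dist_le_zero.1 huniq

/-! ### Right equivalence along the homotopy -/

theorem RightEquivalent.refl {n : ℕ} (f : EuclideanSpace ℝ (Fin n) → ℝ) :
    RightEquivalent 0 f f :=
  ⟨OpenPartialHomeomorph.refl _, Set.mem_univ _, rfl, contDiffOn_id, contDiffOn_id,
    Eventually.of_forall fun _ => rfl⟩

theorem RightEquivalent.trans {n : ℕ} {f g h : EuclideanSpace ℝ (Fin n) → ℝ}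
    (hfg : RightEquivalent 0 f g) (hgh : RightEquivalent 0 g h) : RightEquivalent 0 f h := by
  obtain ⟨φ, h0, hφ0, -, -, he⟩ := hfg
  obtain ⟨ψ, k0, hψ0, -, -, ke⟩ := hgh
  refine ⟨φ.trans ψ, ?_, ?_, contDiffOn_zero.2 (φ.trans ψ).continuousOn,
    contDiffOn_zero.2 (φ.trans ψ).continuousOn_symm, ?_⟩
  · rw [OpenPartialHomeomorph.trans_source]
    exact ⟨h0, by rwa [Set.mem_preimage, hφ0]⟩
  · rw [OpenPartialHomeomorph.coe_trans, Function.comp_apply, hφ0, hψ0]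
  · have hc : Tendsto φ (𝓝 0) (𝓝 0) := by
      have := φ.continuousAt h0
      rwa [ContinuousAt, hφ0] at this
    filter_upwards [he, hc.eventually ke] with x hx hx'
    rw [hx, hx', OpenPartialHomeomorph.coe_trans, Function.comp_apply]

/-- `f + t₀ h` and `f + (t₀ + T) h` are right equivalent for small `T`: flow along the field
`-(h / ‖∇f + t ∇h‖²) (∇f + t ∇h)`. -/
theorem rightEquivalent_add_smul_of_short_time {n : ℕ} {f h : EuclideanSpace ℝ (Fin n) → ℝ}
    {p b : EuclideanSpace ℝ (Fin n) → EuclideanSpace ℝ (Fin n)} {R C D t₀ T : ℝ} {L K : ℝ≥0}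
    (hR : 0 < R) (hC : 0 ≤ C) (hD : 0 ≤ D) (hT : 0 ≤ T) (ht₀ : 0 ≤ t₀) (hT1 : t₀ + T ≤ 1)
    (hf : ∀ x ∈ Metric.closedBall 0 R, HasGradientAt f (p x) x)
    (hh : ∀ x ∈ Metric.closedBall 0 R, HasGradientAt h (b x) x)
    (hp : ∀ t ∈ Set.Icc (0 : ℝ) 1, LipschitzOnWith L (fun x => p x + t • b x)
      (Metric.closedBall 0 R))
    (hhp : ∀ t ∈ Set.Icc (0 : ℝ) 1, ∀ x ∈ Metric.closedBall 0 R, |h x| ≤ C * ‖p x + t • b x‖ ^ 2)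
    (hbp : ∀ t ∈ Set.Icc (0 : ℝ) 1, ∀ x ∈ Metric.closedBall 0 R, ‖b x‖ ≤ D * ‖p x + t • b x‖)
    (hp0 : p 0 = 0) (hK : (2 * C + D * (1 + L) + C * L).toNNReal = K) (hKT : K * T ≤ 1 / 4) :
    RightEquivalent 0 (fun x => f x + t₀ * h x) (fun x => f x + (t₀ + T) * h x) := by
  have hI : Set.Icc t₀ (t₀ + T) ⊆ Set.Icc 0 1 := Set.Icc_subset_Icc ht₀ hT1
  have h0R : (0 : EuclideanSpace ℝ (Fin n)) ∈ Metric.closedBall 0 R :=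
    Metric.mem_closedBall_self hR.le
  have hb0 : b 0 = 0 := by
    have := hbp 0 ⟨le_rfl, zero_le_one⟩ 0 h0R
    simpa [hp0] using this
  obtain ⟨φ, hsrc, hφ0, hφ⟩ := exists_openPartialHomeomorph_flow
    (v := fun t x => -(h x / ‖p x + t • b x‖ ^ 2) • (p x + t • b x)) (K := K) hR hT hKT
    (fun t ht => hK ▸ lipschitzOnWith_neg_div_norm_sq_smul (convex_closedBall 0 R) hC hD hh
      (hp t (hI ht)) (hhp t (hI ht)) (hbp t (hI ht)))
    (fun x hx => by
      -- If h(x) ≠ 0, the bound on h keeps the denominator nonzero for every t.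
      by_cases hhx : h x = 0
      · simp only [hhx, zero_div, neg_zero, zero_smul]
        exact continuousOn_const
      · have hne : ∀ t ∈ Set.Icc t₀ (t₀ + T), ‖p x + t • b x‖ ^ 2 ≠ 0 := fun t ht h0 => by
          have := hhp t (hI ht) x hx
          rw [h0, mul_zero] at this
          exact hhx (abs_nonpos_iff.1 this)
        have hc : ContinuousOn (fun t : ℝ => p x + t • b x) (Set.Icc t₀ (t₀ + T)) := by fun_prop
        exact ((continuousOn_const.div (hc.norm.pow 2) hne).neg).smul hc)
    (fun t _ => by simp [hp0, hb0])
  have h0s : (0 : EuclideanSpace ℝ (Fin n)) ∈ φ.source := by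
    rw [hsrc]
    exact Metric.mem_ball_self (by positivity)
  refine ⟨φ, h0s, hφ0, contDiffOn_zero.2 φ.continuousOn, contDiffOn_zero.2 φ.continuousOn_symm, ?_⟩
  filter_upwards [φ.open_source.mem_nhds h0s] with x hx
  obtain ⟨γ, hγ0, hγ1, hγ⟩ := hφ x hx
  have hderiv : ∀ t ∈ Set.Icc t₀ (t₀ + T), HasDerivWithinAt
      (fun t => f (γ t) + t * h (γ t)) 0 (Set.Icc t₀ (t₀ + T)) t := by
    intro t ht
    obtain ⟨hmem, hd⟩ := hγ t ht
    have h1 := (hf _ hmem).hasFDerivAt.comp_hasDerivWithinAt t hd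
    have h2 := (hh _ hmem).hasFDerivAt.comp_hasDerivWithinAt t hd
    refine (h1.add ((hasDerivWithinAt_id t _).mul h2)).congr_deriv ?_
    simp only [InnerProductSpace.toDual_apply_apply, id, one_mul, Function.comp_apply,
      ← real_inner_smul_left]
    rw [add_left_comm, ← inner_add_left, inner_smul_right, real_inner_self_eq_norm_sq]
    by_cases h0 : ‖p (γ t) + t • b (γ t)‖ ^ 2 = 0
    · have := hhp t (hI ht) _ hmem
      rw [h0, mul_zero] at this
      rw [abs_nonpos_iff.1 this, h0]
      simp
    · linear_combination -(div_mul_cancel₀ (h (γ t)) h0)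
  have := constant_of_has_deriv_right_zero (fun t ht => (hderiv t ht).continuousWithinAt)
    (fun t ht => (hderiv t (Set.Ico_subset_Icc_self ht)).mono_of_mem_nhdsWithin
      (Icc_mem_nhdsGE_of_mem ht)) (t₀ + T) (Set.right_mem_Icc.2 (by linarith))
  simp only [hγ0, hγ1] at this
  exact this.symm

/-- If `∇h` and `h` are dominated by `∇f` and its square, then `f` and `f + h` are right
equivalent. -/
theorem rightEquivalent_add {n : ℕ} {f h : EuclideanSpace ℝ (Fin n) → ℝ}
    {p b : EuclideanSpace ℝ (Fin n) → EuclideanSpace ℝ (Fin n)} {R C : ℝ} {L : ℝ≥0}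
    (hR : 0 < R) (hC : 0 ≤ C)
    (hf : ∀ x ∈ Metric.closedBall 0 R, HasGradientAt f (p x) x)
    (hh : ∀ x ∈ Metric.closedBall 0 R, HasGradientAt h (b x) x)
    (hp : ∀ t ∈ Set.Icc (0 : ℝ) 1, LipschitzOnWith L (fun x => p x + t • b x)
      (Metric.closedBall 0 R))
    (hhp : ∀ x ∈ Metric.closedBall 0 R, |h x| ≤ C * ‖p x‖ ^ 2)
    (hbp : ∀ x ∈ Metric.closedBall 0 R, ‖b x‖ ≤ ‖p x‖ / 2) (hp0 : p 0 = 0) :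
    RightEquivalent 0 f (fun x => f x + h x) := by
  have hpt : ∀ t ∈ Set.Icc (0 : ℝ) 1, ∀ x ∈ Metric.closedBall 0 R,
      ‖p x‖ ≤ 2 * ‖p x + t • b x‖ := by
    intro t ht x hx
    have h1 : ‖p x‖ ≤ ‖p x + t • b x‖ + ‖t • b x‖ := by
      simpa using norm_sub_le (p x + t • b x) (t • b x)
    have h2 : ‖t • b x‖ ≤ ‖b x‖ := by
      rw [norm_smul, Real.norm_of_nonneg ht.1]
      exact mul_le_of_le_one_left (norm_nonneg _) ht.2
    linarith [hbp x hx]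
  -- Since |∇f| ≤ 2|∇f_t|, the constants relative to ∇f_t become 4C and 1. `K` does not depend on t,
  -- so one step length 1/N serves throughout.
  set K : ℝ≥0 := (2 * (4 * C) + 1 * (1 + L) + 4 * C * L).toNNReal with hK
  obtain ⟨N, hN⟩ := exists_nat_gt (4 * (K : ℝ))
  have hN0 : (0 : ℝ) < N := lt_of_le_of_lt (by positivity) hN
  have hstep : ∀ k : ℕ, k ≤ N → RightEquivalent 0 f (fun x => f x + (k / N : ℝ) * h x) := by
    intro k
    induction k with
    | zero => intro _; simpa using RightEquivalent.refl f
    | succ k ih =>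
      intro hk
      have hk' : ((k : ℝ) + 1) ≤ N := by exact_mod_cast hk
      refine (ih (by omega)).trans ?_
      have := rightEquivalent_add_smul_of_short_time (t₀ := k / N) (T := 1 / N) (C := 4 * C)
        (D := 1) (K := K) hR (by positivity) zero_le_one (by positivity) (by positivity)
        (by rw [← add_div]; exact (div_le_one hN0).2 hk') hf hh hp
        (fun t ht x hx => by
          refine (hhp x hx).trans ?_
          calc C * ‖p x‖ ^ 2 ≤ C * (2 * ‖p x + t • b x‖) ^ 2 := by
                gcongr
                exact hpt t ht x hx
            _ = _ := by ring)
        (fun t ht x hx => by linarith [hpt t ht x hx, hbp x hx]) hp0 hK.symm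
        (by rw [mul_one_div, div_le_iff₀ hN0]; linarith)
      rw [← add_div] at this
      exact_mod_cast this
  have := hstep N le_rfl
  rw [div_self hN0.ne'] at this
  simpa using this

theorem mainTheorem3 (n : ℕ) (f g : EuclideanSpace ℝ (Fin n) → ℝ)
    (U : Set (EuclideanSpace ℝ (Fin n))) (hU : IsOpen U)
    (h0U : (0 : EuclideanSpace ℝ (Fin n)) ∈ U)
    (hf0 : f 0 = 0) (hg0 : g 0 = 0)
    (hf : ContDiffOn ℝ 1 f U) (hg : ContDiffOn ℝ 1 g U)
    (hfL : LocallyLipschitzOn U (gradient f)) (hgL : LocallyLipschitzOn U (gradient g))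
    (hf'0 : gradient f 0 = 0)
    (hfun : ∃ C : ℝ, 0 < C ∧ ∀ᶠ x in 𝓝 (0 : EuclideanSpace ℝ (Fin n)),
      |g x - f x| ≤ C * ‖gradient f x‖ ^ 2)
    (hgrad : ∃ C' : ℝ, 0 < C' ∧ ∀ᶠ x in 𝓝 (0 : EuclideanSpace ℝ (Fin n)),
      ‖gradient (fun y => g y - f y) x‖ ≤ C' * ‖gradient f x‖ ^ 2) :
    RightEquivalent 0 f g := by
  obtain ⟨C, hC, hfun⟩ := hfun
  obtain ⟨C', hC', hgrad⟩ := hgrad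
  obtain ⟨L₁, s₁, hs₁, hL₁⟩ := hfL h0U
  obtain ⟨L₂, s₂, hs₂, hL₂⟩ := hgL h0U
  rw [hU.nhdsWithin_eq h0U] at hs₁ hs₂
  -- This threshold turns C'|∇f|² into at most |∇f| / 2.
  have hsmall : ∀ᶠ x in 𝓝 (0 : EuclideanSpace ℝ (Fin n)), ‖gradient f x‖ < 1 / (2 * C') := by
    have hc := (hL₁.continuousOn.continuousAt hs₁).norm
    rw [ContinuousAt, hf'0, norm_zero] at hc
    exact hc.eventually_lt_const (by positivity)
  obtain ⟨R, hR, hball⟩ := Metric.nhds_basis_closedBall.mem_iff.1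
    (inter_mem (inter_mem (hU.mem_nhds h0U) (inter_mem hs₁ hs₂))
      (hfun.and (hgrad.and hsmall)))
  have hd : ∀ {u : EuclideanSpace ℝ (Fin n) → ℝ}, ContDiffOn ℝ 1 u U →
      ∀ x ∈ Metric.closedBall 0 R, HasGradientAt u (gradient u x) x := fun hu x hx =>
    ((hu.differentiableOn one_ne_zero).differentiableAt
      (hU.mem_nhds (hball hx).1.1)).hasGradientAt
  have hsub : ∀ x ∈ Metric.closedBall 0 R,
      HasGradientAt (fun y => g y - f y) (gradient g x - gradient f x) x := fun x hx => by
    rw [hasGradientAt_iff_hasFDerivAt, map_sub]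
    exact (hd hg x hx).hasFDerivAt.sub (hd hf x hx).hasFDerivAt
  have key := rightEquivalent_add (L := L₁ + (L₂ + L₁)) hR hC.le (hd hf) hsub
    (fun t ht => LipschitzOnWith.of_dist_le_mul fun x hx y hy => by
      have h1 := hL₁.norm_sub_le (hball hx).1.2.1 (hball hy).1.2.1
      have h2 := hL₂.norm_sub_le (hball hx).1.2.2 (hball hy).1.2.2
      rw [dist_eq_norm, dist_eq_norm]
      have e : gradient f x + t • (gradient g x - gradient f x)
          - (gradient f y + t • (gradient g y - gradient f y)) =
          (gradient f x - gradient f y) + t • ((gradient g x - gradient g y)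
            - (gradient f x - gradient f y)) := by module
      rw [e]
      refine (norm_add_le _ _).trans ?_
      rw [norm_smul, Real.norm_of_nonneg ht.1]
      have h3 := norm_sub_le (gradient g x - gradient g y) (gradient f x - gradient f y)
      have h4 := mul_le_of_le_one_left (norm_nonneg ((gradient g x - gradient g y)
            - (gradient f x - gradient f y))) ht.2
      push_cast
      linarith)
    (fun x hx => (hball hx).2.1)
    (fun x hx => by
      have h1 := (hball hx).2.2.1
      have h2 := (hball hx).2.2.2
      rw [(hsub x hx).gradient] at h1
      refine h1.trans ?_
      rw [lt_div_iff₀ (by positivity)] at h2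
      nlinarith [norm_nonneg (gradient f x)]) hf'0
  simpa using key
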